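/- Theorem 1.2: There is an absolute constant $\gamma > 0$ (one can choose $\gamma = 0.151$) such that the following holds. Let $m, n$ be non-negative integers and let $q_1, \ldots, q_m : \mathbb{R}^n \to \mathbb{R}$ be real quadratic forms such that $$|q_k(x)| \le \frac{1}{\max\{m,n\}}\, \|x\|^2 \quad \text{for all } x \in \mathbb{R}^n \text{ and } k = 1, \ldots, m,$$ where $\|x\| = \sqrt{x_1^2 + \cdots + x_n^2}$ is the Euclidean norm. Then $$\frac{1}{(2\pi)^{n/2}} \int_{\mathbb{R}^n} \bigl(1 + \omega q_1(x)\bigr) \cdots \bigl(1 + \omega q_m(x)\bigr)\, e^{-\|x\|^2/2}\, dx \ne 0$$ for all $\omega \in \mathbb{C}$ such that $|\omega| \le \gamma$. -/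

import Mathlib

open MeasureTheory Finset
open scoped InnerProductSpace

section GaussianIntegrals

variable {E : Type*} [NormedAddCommGroup E]

/-! Represent each form by a symmetric operator `Q j` and build the product one factor at a time.
Gaussian integration by parts turns the average of `⟪M x, x⟫` times a product into `trace M` times
the average of the product, plus terms of the same kind with one factor fewer and `Q j ∘ M` in place
of `M` (`quadAvgWith_eq`). One induction on the set of factors (`quadAvg_estimates`) then shows that
each new factor changes the average by at most half of its modulus, so it never vanishes. This works
for `‖ω‖ ≤ 1 / 6`, hence for 0.151. -/

/-- The unnormalized standard Gaussian density, as a complex-valued function. -/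
noncomputable def gaussianWeight (x : E) : ℂ := ((Real.exp (-‖x‖ ^ 2 / 2) : ℝ) : ℂ)

lemma norm_gaussianWeight (x : E) : ‖gaussianWeight x‖ = Real.exp (-‖x‖ ^ 2 / 2) := by
  rw [gaussianWeight, Complex.norm_real, Real.norm_of_nonneg (Real.exp_nonneg _)]

lemma continuous_gaussianWeight : Continuous (gaussianWeight : E → ℂ) := by
  unfold gaussianWeight
  fun_prop

variable [InnerProductSpace ℝ E]

lemma hasFDerivAt_gaussianWeight (x : E) :
    HasFDerivAt (gaussianWeight : E → ℂ)
      (-(gaussianWeight x) • (Complex.ofRealCLM.comp (innerSL ℝ x))) x := by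
  have h1 : HasFDerivAt (fun y : E => -‖y‖ ^ 2 / 2) (-(innerSL ℝ x)) x := by
    have h2 := ((hasStrictFDerivAt_norm_sq x).hasFDerivAt (𝕜 := ℝ)).const_mul (-1 / 2 : ℝ)
    convert! h2 using 1
    · ext y; ring
    · ext y; simp; ring
  convert! Complex.ofRealCLM.hasFDerivAt.comp x h1.exp using 1
  ext y
  simp [gaussianWeight]

/-- Absorbs polynomial growth into a wider Gaussian, so that temperate growth suffices for
integrability. -/
lemma one_add_pow_mul_exp_le (k : ℕ) {t : ℝ} (ht : 0 ≤ t) :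
    (1 + t) ^ k * Real.exp (-t ^ 2 / 2) ≤
      (k.factorial * Real.exp 2) * Real.exp (-(1 / 4) * t ^ 2) := by
  have h1 : (1 + t) ^ k ≤ k.factorial * Real.exp (1 + t) := by
    have := Real.pow_div_factorial_le_exp (1 + t) (by linarith) k
    rwa [div_le_iff₀' (by positivity)] at this
  calc (1 + t) ^ k * Real.exp (-t ^ 2 / 2)
      ≤ k.factorial * Real.exp (1 + t) * Real.exp (-t ^ 2 / 2) := by gcongr
    _ = k.factorial * Real.exp (1 + t + -t ^ 2 / 2) := by rw [mul_assoc, ← Real.exp_add]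
    _ ≤ k.factorial * Real.exp (2 + -(1 / 4) * t ^ 2) := by
        refine mul_le_mul_of_nonneg_left (Real.exp_le_exp.2 ?_) (by positivity)
        nlinarith [sq_nonneg (t - 2)]
    _ = _ := by rw [Real.exp_add, mul_assoc]

lemma Function.HasTemperateGrowth.fderiv_apply_const {F : E → ℂ}
    (hF : F.HasTemperateGrowth) (v : E) : (fun x => fderiv ℝ F x v).HasTemperateGrowth := by
  have h : (fderiv ℝ F).HasTemperateGrowth := by
    refine ⟨hF.1.fderiv_right (by simp), fun n => ?_⟩
    obtain ⟨k, C, h⟩ := hF.2 (n + 1)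
    exact ⟨k, C, fun x => norm_iteratedFDeriv_fderiv.trans_le (h x)⟩
  exact (ContinuousLinearMap.apply ℝ ℂ v).hasTemperateGrowth.comp h

lemma hasTemperateGrowth_inner_clm (M : E →L[ℝ] E) :
    (fun x : E => (⟪M x, x⟫_ℝ : ℂ)).HasTemperateGrowth :=
  Function.Complex.hasTemperateGrowth_ofReal.comp
    ((innerSL ℝ).bilinear_hasTemperateGrowth M.hasTemperateGrowth .id')

/-! ### Products of quadratic factors and their derivatives -/

section Products

variable {ι : Type*} [DecidableEq ι] (Q : ι → E →L[ℝ] E) (ω : ℂ)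

/-- The product of the factors `1 + ω ⟪Q j x, x⟫` over `j ∈ B`. -/
noncomputable def quadProd (B : Finset ι) (x : E) : ℂ := ∏ j ∈ B, (1 + ω * (⟪Q j x, x⟫_ℝ : ℂ))

lemma hasTemperateGrowth_quadProd (B : Finset ι) : (quadProd Q ω B).HasTemperateGrowth := by
  induction B using Finset.induction_on with
  | empty =>
    have : quadProd Q ω ∅ = fun _ => 1 := by ext; simp [quadProd]
    rw [this]
    exact .const 1
  | insert k B hk ih =>
    have : quadProd Q ω (insert k B)
        = (fun x => 1 + ω * (⟪Q k x, x⟫_ℝ : ℂ)) * quadProd Q ω B := by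
      ext x; simp [quadProd, prod_insert hk]
    rw [this]
    exact ((Function.HasTemperateGrowth.const 1).add
      ((Function.HasTemperateGrowth.const ω).mul (hasTemperateGrowth_inner_clm (Q k)))).mul ih

lemma fderiv_quadProd {Q : ι → E →L[ℝ] E} (hQ : ∀ j x y, ⟪Q j x, y⟫_ℝ = ⟪x, Q j y⟫_ℝ)
    (B : Finset ι) (x v : E) :
    fderiv ℝ (quadProd Q ω B) x v =
      ∑ j ∈ B, 2 * ω * (⟪Q j v, x⟫_ℝ : ℂ) * quadProd Q ω (B.erase j) x := by
  have h1 (j : ι) : HasFDerivAt (fun x : E => 1 + ω * (⟪Q j x, x⟫_ℝ : ℂ))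
      (ω • Complex.ofRealCLM.comp
        ((fderivInnerCLM ℝ (Q j x, x)).comp ((Q j).prod (.id ℝ E)))) x :=
    ((Complex.ofRealCLM.hasFDerivAt.comp x
      ((Q j).hasFDerivAt.inner ℝ (hasFDerivAt_id x))).const_mul ω).const_add 1
  rw [show quadProd Q ω B = fun x => ∏ j ∈ B, (1 + ω * (⟪Q j x, x⟫_ℝ : ℂ)) from rfl,
    (HasFDerivAt.finsetProd fun j _ => h1 j).fderiv]
  simp only [_root_.sum_apply]
  refine sum_congr rfl fun j _ => ?_
  have h2 : ⟪Q j x, v⟫_ℝ = ⟪Q j v, x⟫_ℝ := by rw [hQ, real_inner_comm]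
  simp [quadProd, fderivInnerCLM_apply, h2]
  ring

end Products

/-! ### Trace bound and operators of quadratic forms -/

variable [FiniteDimensional ℝ E]

lemma abs_trace_le_finrank_mul_norm (M : E →L[ℝ] E) :
    |LinearMap.trace ℝ E M| ≤ Module.finrank ℝ E * ‖M‖ := by
  set b := stdOrthonormalBasis ℝ E
  rw [LinearMap.trace_eq_sum_inner _ b]
  calc |∑ i, ⟪b i, (M : E →ₗ[ℝ] E) (b i)⟫_ℝ| ≤ ∑ i, |⟪b i, M (b i)⟫_ℝ| := abs_sum_le_sum_abs _ _
    _ ≤ ∑ _i : Fin (Module.finrank ℝ E), ‖M‖ := by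
        refine sum_le_sum fun i _ => (abs_real_inner_le_norm _ _).trans ?_
        simpa using M.le_opNorm (b i)
    _ = _ := by simp

/-- A quadratic form is represented by a self-adjoint operator whose norm is controlled by the
values of the form on the unit sphere. -/
lemma QuadraticForm.exists_symmetric_clm (q : QuadraticForm ℝ E) {D : ℝ} (hD : 0 ≤ D)
    (hq : ∀ x, |q x| ≤ D * ‖x‖ ^ 2) :
    ∃ Q : E →L[ℝ] E, (∀ x, ⟪Q x, x⟫_ℝ = q x) ∧ (∀ x y, ⟪Q x, y⟫_ℝ = ⟪x, Q y⟫_ℝ) ∧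
      ‖Q‖ ≤ D := by
  set A : LinearMap.BilinForm ℝ E := QuadraticMap.associated q with hA
  let L : E →ₗ[ℝ] E :=
    { toFun := fun x => (InnerProductSpace.toDual ℝ E).symm (A x).toContinuousLinearMap
      map_add' := fun x y => by simp
      map_smul' := fun c x => by simp }
  have hL (x y : E) : ⟪L x, y⟫_ℝ = A x y := by simp [L]
  have hsymm (x y : E) : A x y = A y x := QuadraticMap.associated_isSymm ℝ q x y
  have hdiag (x : E) : A x x = q x := QuadraticMap.associated_eq_self_apply ℝ q x
  have hpol (x y : E) : 4 * A x y = q (x + y) - q (x - y) := by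
    rw [← hdiag, ← hdiag]
    simp only [map_add, map_sub, LinearMap.add_apply, LinearMap.sub_apply, hsymm y x]
    ring
  have hbound (x y : E) : 2 * A x y ≤ D * (‖x‖ ^ 2 + ‖y‖ ^ 2) := by
    have h1 := (abs_le.1 (hq (x + y))).2
    have h2 := (abs_le.1 (hq (x - y))).1
    have h3 := parallelogram_law_with_norm ℝ x y
    have h4 : D * ‖x + y‖ ^ 2 + D * ‖x - y‖ ^ 2 = 2 * (D * (‖x‖ ^ 2 + ‖y‖ ^ 2)) := by
      linear_combination D * h3
    linarith [hpol x y]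
  have hnorm (x : E) : ‖L x‖ ≤ D * ‖x‖ := by
    obtain hx | hx := (norm_nonneg (L x)).eq_or_lt
    · rw [← hx]; positivity
    obtain hx0 | hx0 := (norm_nonneg x).eq_or_lt
    · rw [norm_eq_zero.1 hx0.symm] at hx; simp at hx
    -- Rescaling gives both vectors the norm `‖L x‖ * ‖x‖`, so the sum of squares in `hbound` loses
    -- nothing.
    have h := hbound (‖L x‖ • x) (‖x‖ • L x)
    have h2 : A (‖L x‖ • x) (‖x‖ • L x) = ‖L x‖ * ‖x‖ * ‖L x‖ ^ 2 := by
      rw [← hL, map_smul, real_inner_smul_left, real_inner_smul_right, real_inner_self_eq_norm_sq]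
      ring
    rw [h2, norm_smul, norm_smul, norm_norm, norm_norm] at h
    have hpos : 0 < 2 * (‖L x‖ ^ 2 * ‖x‖) := by positivity
    refine le_of_mul_le_mul_left ?_ hpos
    linarith
  exact ⟨L.mkContinuous D hnorm, fun x => (hL x x).trans (hdiag x),
    fun x y => by
      rw [LinearMap.mkContinuous_apply, LinearMap.mkContinuous_apply, hL, hsymm, ← hL,
        real_inner_comm],
    L.mkContinuous_norm_le hD hnorm⟩

/-! ### Gaussian integrability and integration by parts -/

variable [MeasurableSpace E] [BorelSpace E]

lemma integrable_exp_neg_mul_sq_norm {b : ℝ} (hb : 0 < b) :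
    Integrable (fun x : E => Real.exp (-b * ‖x‖ ^ 2)) := by
  have h := (GaussianFourier.integrable_cexp_neg_mul_sq_norm_add (b := (b : ℂ)) (V := E)
    (by simpa using hb) 0 0).norm
  refine h.congr (.of_forall fun x => ?_)
  simp only [Complex.norm_exp]
  congr 1
  simp [← Complex.ofReal_pow]

lemma integrable_mul_gaussianWeight {F : E → ℂ} (hF : F.HasTemperateGrowth) :
    Integrable (fun x => F x * gaussianWeight x) := by
  obtain ⟨k, C, hC⟩ := hF.2 0
  refine (((integrable_exp_neg_mul_sq_norm (E := E) (b := 1 / 4) (by norm_num)).const_mul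
    (k.factorial * Real.exp 2)).const_mul C).mono'
    (hF.1.continuous.mul continuous_gaussianWeight).aestronglyMeasurable (.of_forall fun x => ?_)
  have h := hC x
  rw [norm_iteratedFDeriv_zero] at h
  have hC0 : 0 ≤ C := by
    have h0 := hC 0
    simp only [norm_zero, add_zero, one_pow, mul_one] at h0
    exact (norm_nonneg _).trans h0
  calc ‖F x * gaussianWeight x‖ = ‖F x‖ * Real.exp (-‖x‖ ^ 2 / 2) := by
        rw [norm_mul, norm_gaussianWeight]
    _ ≤ C * (1 + ‖x‖) ^ k * Real.exp (-‖x‖ ^ 2 / 2) := by gcongr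
    _ = C * ((1 + ‖x‖) ^ k * Real.exp (-‖x‖ ^ 2 / 2)) := by ring
    _ ≤ _ := mul_le_mul_of_nonneg_left (one_add_pow_mul_exp_le k (norm_nonneg x)) hC0

lemma integral_gaussianWeight_ne_zero : ∫ x : E, gaussianWeight x ≠ 0 := by
  have h1 : ∫ x : E, gaussianWeight x = ((∫ x : E, Real.exp (-(1 / 2) * ‖x‖ ^ 2) : ℝ) : ℂ) := by
    rw [← integral_complex_ofReal]
    refine integral_congr_ae (.of_forall fun x => ?_)
    simp only [gaussianWeight]
    congr 2
    ring
  rw [h1, GaussianFourier.integral_rexp_neg_mul_sq_norm (by norm_num)]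
  exact_mod_cast (by positivity : (Real.pi / (1 / 2)) ^ (Module.finrank ℝ E / 2 : ℝ) ≠ 0)

/-- Gaussian integration by parts in one direction. -/
lemma integral_inner_mul_gaussianWeight {F : E → ℂ} (hF : F.HasTemperateGrowth) (v : E) :
    ∫ x, (F x * (⟪x, v⟫_ℝ : ℂ)) * gaussianWeight x = ∫ x, fderiv ℝ F x v * gaussianWeight x := by
  have hF' : (fun x => fderiv ℝ F x v).HasTemperateGrowth :=
    hF.fderiv_apply_const v
  have hi : (fun x : E => F x * (⟪x, v⟫_ℝ : ℂ)).HasTemperateGrowth :=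
    hF.mul (Function.Complex.hasTemperateGrowth_ofReal.comp
      (Function.hasTemperateGrowth_inner_left v))
  have hg : ∀ x, F x * fderiv ℝ gaussianWeight x v
      = -((F x * (⟪x, v⟫_ℝ : ℂ)) * gaussianWeight x) := fun x => by
    rw [(hasFDerivAt_gaussianWeight x).fderiv]
    simp
    ring
  have h := integral_mul_fderiv_eq_neg_fderiv_mul_of_integrable (μ := volume) (v := v)
    (f := F) (g := gaussianWeight) (integrable_mul_gaussianWeight hF')
    (by simp only [hg]; exact (integrable_mul_gaussianWeight hi).neg)
    (integrable_mul_gaussianWeight hF)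
    (fun x _ => hF.1.differentiable (by simp) x)
    (fun x _ => (hasFDerivAt_gaussianWeight x).differentiableAt)
  simp only [hg, integral_neg] at h
  exact neg_injective h

/-- Gaussian integration by parts against the linear vector field `M`. -/
lemma integral_inner_clm_mul_gaussianWeight {F : E → ℂ} (hF : F.HasTemperateGrowth)
    (M : E →L[ℝ] E) :
    ∫ x, ((⟪M x, x⟫_ℝ : ℂ) * F x) * gaussianWeight x =
      (LinearMap.trace ℝ E M : ℂ) * (∫ x, F x * gaussianWeight x)
        + ∫ x, fderiv ℝ F x (M x) * gaussianWeight x := by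
  set b := stdOrthonormalBasis ℝ E
  have hd : Differentiable ℝ F := hF.1.differentiable (by simp)
  have hF' (v : E) : (fun x => fderiv ℝ F x v).HasTemperateGrowth :=
    hF.fderiv_apply_const v
  have hl (v : E) : (fun x : E => (⟪M x, v⟫_ℝ : ℂ)).HasTemperateGrowth :=
    Function.Complex.hasTemperateGrowth_ofReal.comp
      ((Function.hasTemperateGrowth_inner_left v).comp M.hasTemperateGrowth)
  have hi (v : E) : (fun x : E => (⟪x, v⟫_ℝ : ℂ)).HasTemperateGrowth :=
    Function.Complex.hasTemperateGrowth_ofReal.comp (Function.hasTemperateGrowth_inner_left v)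
  have hG (i) : (fun x => (⟪M x, b i⟫_ℝ : ℂ) * F x).HasTemperateGrowth := (hl _).mul hF
  have hder (i) (x : E) : fderiv ℝ (fun x => (⟪M x, b i⟫_ℝ : ℂ) * F x) x (b i) =
      (⟪b i, M (b i)⟫_ℝ : ℂ) * F x + (⟪M x, b i⟫_ℝ : ℂ) * fderiv ℝ F x (b i) := by
    have h1 : HasFDerivAt (fun x : E => (⟪M x, b i⟫_ℝ : ℂ))
        (Complex.ofRealCLM.comp ((innerSL ℝ (b i)).comp M)) x := by
      convert! (Complex.ofRealCLM.comp ((innerSL ℝ (b i)).comp M)).hasFDerivAt using 1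
      ext y
      simp [real_inner_comm]
    have h2 := h1.mul (hd x).hasFDerivAt
    rw [show (fun x => (⟪M x, b i⟫_ℝ : ℂ) * F x) = (fun x => (⟪M x, b i⟫_ℝ : ℂ)) * F from rfl,
      h2.fderiv]
    simp
    ring
  have hsum (x : E) : ∑ i, ⟪M x, b i⟫_ℝ * ⟪x, b i⟫_ℝ = ⟪M x, x⟫_ℝ := by
    rw [← b.sum_inner_mul_inner (M x) x]
    simp_rw [real_inner_comm x]
  have hexp (x : E) : ∑ i, (⟪M x, b i⟫_ℝ : ℂ) * fderiv ℝ F x (b i) = fderiv ℝ F x (M x) := by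
    conv_rhs => rw [← b.sum_repr (M x), map_sum]
    refine sum_congr rfl fun i _ => ?_
    rw [map_smul, b.repr_apply_apply, real_inner_comm, Complex.real_smul]
  calc ∫ x, ((⟪M x, x⟫_ℝ : ℂ) * F x) * gaussianWeight x
      = ∫ x, ∑ i, (((⟪M x, b i⟫_ℝ : ℂ) * F x) * (⟪x, b i⟫_ℝ : ℂ)) * gaussianWeight x := by
        refine integral_congr_ae (.of_forall fun x => ?_)
        simp only [← hsum x]
        push_cast
        simp only [sum_mul]
        exact sum_congr rfl fun i _ => by ring
    _ = ∑ i, ∫ x, (((⟪M x, b i⟫_ℝ : ℂ) * F x) * (⟪x, b i⟫_ℝ : ℂ)) * gaussianWeight x :=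
        integral_finsetSum _ fun i _ => integrable_mul_gaussianWeight ((hG i).mul (hi _))
    _ = ∑ i, ∫ x, ((⟪b i, M (b i)⟫_ℝ : ℂ) * F x
          + (⟪M x, b i⟫_ℝ : ℂ) * fderiv ℝ F x (b i)) * gaussianWeight x := by
        refine sum_congr rfl fun i _ => ?_
        rw [integral_inner_mul_gaussianWeight (hG i)]
        simp only [hder]
    _ = ∑ i, ((⟪b i, M (b i)⟫_ℝ : ℂ) * (∫ x, F x * gaussianWeight x)
          + ∫ x, (⟪M x, b i⟫_ℝ : ℂ) * fderiv ℝ F x (b i) * gaussianWeight x) := by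
        refine sum_congr rfl fun i _ => ?_
        have h := integrable_mul_gaussianWeight ((hl (b i)).mul (hF' (b i)))
        rw [← integral_const_mul, ← integral_add ((integrable_mul_gaussianWeight hF).const_mul _)
          (by exact h)]
        exact integral_congr_ae (.of_forall fun x => by ring)
    _ = _ := by
        rw [sum_add_distrib, ← sum_mul, LinearMap.trace_eq_sum_inner _ b,
          ← integral_finsetSum _ fun i _ => by
            exact integrable_mul_gaussianWeight ((hl (b i)).mul (hF' (b i)))]
        congr 1
        · push_cast
          rfl
        · refine integral_congr_ae (.of_forall fun x => ?_)
          simp only [← hexp x, sum_mul]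

/-! ### Recursion and induction for the averages -/

section Products

variable {ι : Type*} [DecidableEq ι] (Q : ι → E →L[ℝ] E) (ω : ℂ)

/-- The unnormalized Gaussian average of `quadProd`. -/
noncomputable def quadAvg (B : Finset ι) : ℂ := ∫ x, quadProd Q ω B x * gaussianWeight x

/-- The unnormalized Gaussian average of `⟪M x, x⟫` times `quadProd`. -/
noncomputable def quadAvgWith (B : Finset ι) (M : E →L[ℝ] E) : ℂ :=
  ∫ x, ((⟪M x, x⟫_ℝ : ℂ) * quadProd Q ω B x) * gaussianWeight x

/-- By symmetry of `Q j`, differentiating factor `j` along `M x` gives `2 * ω * ⟪Q j (M x), x⟫`.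
Since `Q j ∘ M` need not be symmetric, `M` must be arbitrary. -/
lemma quadAvgWith_eq {Q : ι → E →L[ℝ] E} (hQ : ∀ j x y, ⟪Q j x, y⟫_ℝ = ⟪x, Q j y⟫_ℝ)
    (B : Finset ι) (M : E →L[ℝ] E) :
    quadAvgWith Q ω B M = (LinearMap.trace ℝ E M : ℂ) * quadAvg Q ω B
      + ∑ j ∈ B, 2 * ω * quadAvgWith Q ω (B.erase j) ((Q j).comp M) := by
  rw [quadAvgWith, integral_inner_clm_mul_gaussianWeight (hasTemperateGrowth_quadProd Q ω B) M,
    quadAvg]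
  congr 1
  simp only [fderiv_quadProd ω hQ, sum_mul, quadAvgWith, ← integral_const_mul]
  rw [integral_finsetSum]
  · refine sum_congr rfl fun j _ => integral_congr_ae (ae_of_all _ fun x => ?_)
    simp only [ContinuousLinearMap.comp_apply]
    ring
  · intro j _
    have h := (integrable_mul_gaussianWeight
      ((hasTemperateGrowth_inner_clm ((Q j).comp M)).mul
        (hasTemperateGrowth_quadProd Q ω (B.erase j)))).const_mul (2 * ω)
    refine h.congr (ae_of_all _ fun x => ?_)
    simp only [ContinuousLinearMap.comp_apply, Pi.mul_apply]
    ring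

lemma quadAvg_insert {B : Finset ι} {k : ι} (hk : k ∉ B) :
    quadAvg Q ω (insert k B) = quadAvg Q ω B + ω * quadAvgWith Q ω B (Q k) := by
  have hP := hasTemperateGrowth_quadProd Q ω B
  rw [quadAvg, quadAvg, quadAvgWith, ← integral_const_mul,
    ← integral_add (integrable_mul_gaussianWeight hP)
      (by exact (integrable_mul_gaussianWeight
        ((hasTemperateGrowth_inner_clm (Q k)).mul hP)).const_mul ω)]
  refine integral_congr_ae (.of_forall fun x => ?_)
  simp only [quadProd, prod_insert hk]
  ring

/-- The inductive estimate: removing a factor changes the average at most by a factor of two. -/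
theorem quadAvg_estimates {Q : ι → E →L[ℝ] E} {ω : ℂ}
    (hQ : ∀ j x y, ⟪Q j x, y⟫_ℝ = ⟪x, Q j y⟫_ℝ) {D : ℝ} (hD : 0 ≤ D)
    (hQD : ∀ j, ‖Q j‖ ≤ D) (hn : D * Module.finrank ℝ E ≤ 1) (hω : ‖ω‖ ≤ 1 / 6) (B : Finset ι)
    (hB : D * B.card ≤ 1) :
    quadAvg Q ω B ≠ 0 ∧ (∀ j ∈ B, ‖quadAvg Q ω (B.erase j)‖ ≤ 2 * ‖quadAvg Q ω B‖) ∧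
      ∀ M : E →L[ℝ] E,
        ‖quadAvgWith Q ω B M‖ ≤ ‖M‖ * (3 * Module.finrank ℝ E) * ‖quadAvg Q ω B‖ := by
  induction B using Finset.strongInduction with
  | H B ih =>
  have ih' (j) (hj : j ∈ B) := ih (B.erase j) (erase_ssubset hj)
    ((mul_le_mul_of_nonneg_left (by exact_mod_cast card_le_card (erase_subset j B)) hD).trans hB)
  have hstep (j) (hj : j ∈ B) : ‖quadAvg Q ω (B.erase j)‖ ≤ 2 * ‖quadAvg Q ω B‖ := by
    have h1 := quadAvg_insert Q ω (notMem_erase j B)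
    rw [insert_erase hj] at h1
    have h2 := (ih' j hj).2.2 (Q j)
    -- The threshold 1/6 is what makes 3 · ‖ω‖ ≤ 1/2.
    have h3 : ‖ω * quadAvgWith Q ω (B.erase j) (Q j)‖ ≤ 1 / 2 * ‖quadAvg Q ω (B.erase j)‖ := by
      rw [norm_mul]
      calc ‖ω‖ * ‖quadAvgWith Q ω (B.erase j) (Q j)‖
          ≤ 1 / 6 * (D * (3 * Module.finrank ℝ E) * ‖quadAvg Q ω (B.erase j)‖) := by
            gcongr
            exact h2.trans (by gcongr; exact hQD j)
        _ = 1 / 2 * ((D * Module.finrank ℝ E) * ‖quadAvg Q ω (B.erase j)‖) := by ring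
        _ ≤ 1 / 2 * (1 * ‖quadAvg Q ω (B.erase j)‖) := by gcongr
        _ = _ := by ring
    have h4 := norm_sub_le (quadAvg Q ω B) (ω * quadAvgWith Q ω (B.erase j) (Q j))
    rw [h1, add_sub_cancel_right, ← h1] at h4
    linarith
  refine ⟨?_, hstep, fun M => ?_⟩
  · obtain rfl | ⟨j, hj⟩ := B.eq_empty_or_nonempty
    · simpa [quadAvg, quadProd] using integral_gaussianWeight_ne_zero (E := E)
    · intro h0
      have := hstep j hj
      rw [h0, norm_zero, mul_zero, norm_le_zero_iff] at this
      exact (ih' j hj).1 this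
  -- The constant 3 reproduces itself: 1 from the trace, and 2 · (1/6) · 3 · 2 = 2 from the sum over
  -- `j`, using `D * B.card ≤ 1`.
  · have hterm (j) (hj : j ∈ B) : ‖2 * ω * quadAvgWith Q ω (B.erase j) ((Q j).comp M)‖ ≤
        2 * ‖M‖ * Module.finrank ℝ E * ‖quadAvg Q ω B‖ * D := by
      rw [norm_mul, norm_mul, Complex.norm_ofNat]
      calc 2 * ‖ω‖ * ‖quadAvgWith Q ω (B.erase j) ((Q j).comp M)‖
          ≤ 2 * (1 / 6) * ((D * ‖M‖) * (3 * Module.finrank ℝ E) * (2 * ‖quadAvg Q ω B‖)) := by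
            gcongr
            refine ((ih' j hj).2.2 _).trans ?_
            gcongr
            · exact ((Q j).opNorm_comp_le M).trans (by gcongr; exact hQD j)
            · exact hstep j hj
        _ = _ := by ring
    rw [quadAvgWith_eq ω hQ]
    calc _ ≤ ‖(LinearMap.trace ℝ E M : ℂ) * quadAvg Q ω B‖
            + ∑ j ∈ B, ‖2 * ω * quadAvgWith Q ω (B.erase j) ((Q j).comp M)‖ :=
          (norm_add_le _ _).trans (by gcongr; exact norm_sum_le _ _)
      _ ≤ Module.finrank ℝ E * ‖M‖ * ‖quadAvg Q ω B‖
            + ∑ _j ∈ B, 2 * ‖M‖ * Module.finrank ℝ E * ‖quadAvg Q ω B‖ * D := by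
          rw [norm_mul, Complex.norm_real, Real.norm_eq_abs]
          gcongr with j hj
          · exact abs_trace_le_finrank_mul_norm M
          · exact hterm j hj
      _ = Module.finrank ℝ E * ‖M‖ * ‖quadAvg Q ω B‖
            + 2 * ‖M‖ * Module.finrank ℝ E * ‖quadAvg Q ω B‖ * (D * B.card) := by
          rw [sum_const, nsmul_eq_mul]; ring
      _ ≤ Module.finrank ℝ E * ‖M‖ * ‖quadAvg Q ω B‖
            + 2 * ‖M‖ * Module.finrank ℝ E * ‖quadAvg Q ω B‖ * 1 := by gcongr
      _ = _ := by ring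

end Products

end GaussianIntegrals

theorem theorem1p2 :
    ∃ γ : ℝ, 0 < γ ∧ γ = 0.151 ∧
      ∀ (m n : ℕ) (q : Fin m → QuadraticForm ℝ (EuclideanSpace ℝ (Fin n))),
        (∀ (k : Fin m) (x : EuclideanSpace ℝ (Fin n)),
          |q k x| ≤ 1 / ((max m n : ℕ) : ℝ) * ‖x‖ ^ 2) →
        ∀ ω : ℂ, ‖ω‖ ≤ γ →
          ((1 / (2 * Real.pi) ^ ((n : ℝ) / 2) : ℝ) : ℂ) *
            ∫ x : EuclideanSpace ℝ (Fin n),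
              (∏ k : Fin m, (1 + ω * ((q k x : ℝ) : ℂ))) *
                ((Real.exp (-‖x‖ ^ 2 / 2) : ℝ) : ℂ) ≠ 0 := by
  refine ⟨0.151, by norm_num, rfl, fun m n q hq ω hω => ?_⟩
  have hD : (0 : ℝ) ≤ 1 / ((max m n : ℕ) : ℝ) := by positivity
  -- For `m = n = 0` the bound reads `1 / 0 = 0`, and the inequality still holds.
  have hle {k : ℕ} (hk : k ≤ max m n) : 1 / ((max m n : ℕ) : ℝ) * k ≤ 1 := by
    rw [one_div_mul_eq_div]
    exact div_le_one_of_le₀ (by exact_mod_cast hk) (by positivity)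
  choose Q hQq hQs hQn using fun k => (q k).exists_symmetric_clm hD (hq k)
  refine mul_ne_zero ?_ ?_
  · exact_mod_cast (by positivity : 1 / (2 * Real.pi) ^ ((n : ℝ) / 2) ≠ 0)
  · have h := (quadAvg_estimates (ω := ω) hQs hD hQn
      (by rw [finrank_euclideanSpace_fin]; exact hle (le_max_right m n))
      (hω.trans (by norm_num)) univ
      (by rw [card_univ, Fintype.card_fin]; exact hle (le_max_left m n))).1
    simpa only [quadAvg, quadProd, hQq, gaussianWeight] using h
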